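/- Let $A$ be an associative ring with unit having the invariant basis property: if $A^m\cong A^n$ as left $A$-modules, then $m=n$. "Module" means left module. For a free $A$-module $V$ of rank $n$, let $\mathbb{FL}(V)$ be the simplicial complex whose vertices are the full flags $F=(0=F_0\subset F_1\subset\dots\subset F_n=V)$ of submodules with each $F_i/F_{i-1}$ free of rank $1$, and whose simplices are the finite nonempty sets of flags contained in $[\alpha]$ for some $\alpha=\{L_1,\dots,L_n\}$, where the $L_i\subset V$ are free submodules of rank $1$ with $\bigoplus_i L_i\to V$ an isomorphism and $[\alpha]$ is the set of the flags $(0,\,L_{\sigma(1)},\,L_{\sigma(1)}\oplus L_{\sigma(2)},\dots,\,L_{\sigma(1)}\oplus\dots\oplus L_{\sigma(n)})$ for all permutations $\sigma$. The group $\mathrm{Aut}(V)$ acts on $\mathbb{FL}(V)$ by $gF=(gF_0,\dots,gF_n)$, hence on its homology. The inclusion $i:A^n\to A^{n+1}$, $(a_1,\dots,a_n)\mapsto(a_1,\dots,a_n,0)$, induces the simplicial map $\mathbb{FL}(A^n)\to\mathbb{FL}(A^{n+1})$, $(F_0,\dots,F_n)\mapsto(iF_0,\dots,iF_n,A^{n+1})$.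 Let $A^\infty=\bigcup_n A^n$ be the free module of finitely supported sequences. The vertices of $\mathbb{FL}(A^\infty)$ are the flags $0=V_0\subset V_1\subset V_2\subset\cdots$ of submodules of $A^\infty$ with each $V_i/V_{i-1}$ free of rank $1$ and $V_n=A^n$ for all sufficiently large $n$; a finite nonempty set of vertices is a simplex if, for some $n$, it comes from a simplex of $\mathbb{FL}(A^n)$ by extending flags $(F_0,\dots,F_n)$ of $A^n$ to $(F_0,\dots,F_n,A^{n+1},A^{n+2},\dots)$. The group $GL(A)=\bigcup_n GL_n(A)\subset\mathrm{Aut}(A^\infty)$ acts on $\mathbb{FL}(A^\infty)$. Let $E_n(A)\subset GL_n(A)=\mathrm{Aut}(A^n)$ be the subgroup generated by the elementary automorphisms $x\mapsto x+x_i\,a\,e_j$ ($i\ne j$, $a\in A$), and let $E(A)=\bigcup_n E_n(A)\subset GL(A)$. Then: (i) For every $n\ge 0$ and $r\ge 0$, every element of $E_{n+1}(A)$ acts as the identity on the image of the natural map $$i_*:H_r(\mathbb{FL}(A^{n}),\mathbb Z)\to H_r(\mathbb{FL}(A^{n+1}),\mathbb Z).$$ (ii) For every $r\ge 0$, the action of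 $E(A)$ on $H_r(\mathbb{FL}(A^\infty),\mathbb Z)$ is trivial. -/

import Mathlib

universe u v w

noncomputable section

namespace FlagComplex

open CategoryTheory

/-! ## Simplicial maps and homology of abstract simplicial complexes -/

/-- A simplicial map: a map on vertices carrying the vertices of every simplex of `K`
into a simplex of `L`. -/
structure SimplicialMap {α : Type u} {β : Type v} (K : AbstractSimplicialComplex α)
    (L : AbstractSimplicialComplex β) where
  toFun : α → β
  map_face : ∀ s ∈ K.faces, ∃ t ∈ L.faces, ∀ x ∈ s, toFun x ∈ t

/-- The simplicial set of ordered simplices of `K`: its `m`-simplices are the tuples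
`(v₀, …, vₘ)` of vertices (repetitions allowed) that all lie in one simplex of `K`. -/
def orderedSSet {α : Type w} (K : AbstractSimplicialComplex α) : SSet.{w} where
  obj m := {x : Fin (m.unop.len + 1) → α // ∃ s ∈ K.faces, ∀ i, x i ∈ s}
  map f := TypeCat.ofHom fun x =>
    ⟨fun i => x.1 (f.unop.toOrderHom i), by
      obtain ⟨s, hs, h⟩ := x.2
      exact ⟨s, hs, fun i => h _⟩⟩

/-- The map of simplicial sets induced by a simplicial map. -/
def orderedSSetMap {α β : Type w} {K : AbstractSimplicialComplex α}
    {L : AbstractSimplicialComplex β} (f : SimplicialMap K L) :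
    orderedSSet K ⟶ orderedSSet L where
  app m := TypeCat.ofHom fun x =>
    ⟨fun i => f.toFun (x.1 i), by
      obtain ⟨s, hs, h⟩ := x.2
      obtain ⟨t, ht, h'⟩ := f.map_face s hs
      exact ⟨t, ht, fun i => h' _ (h i)⟩⟩

/-- The homology group `H_r(K, ℤ)` of a simplicial complex, computed by the ordered simplicial
chain complex: in degree `r` it is free abelian on the ordered `r`-simplices `(v₀, …, v_r)`, with
boundary `∑ (-1)ⁱ (v₀, …, v̂ᵢ, …, v_r)`. -/
def homology {α : Type w} (K : AbstractSimplicialComplex α) (r : ℕ) : ModuleCat.{w} ℤ :=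
  (orderedSSet K).homology (ModuleCat.of ℤ (ULift.{w} ℤ)) r

/-- The map induced on `H_r(-, ℤ)` by a simplicial map. -/
def homologyMap {α β : Type w} {K : AbstractSimplicialComplex α}
    {L : AbstractSimplicialComplex β} (f : SimplicialMap K L) (r : ℕ) :
    homology K r →ₗ[ℤ] homology L r :=
  (SSet.homologyMap (orderedSSetMap f) (ModuleCat.of ℤ (ULift.{w} ℤ)) r).hom

/-! ## Full flags and splittings -/

section Flags

variable {A : Type u} [Ring A] {V : Type v} [AddCommGroup V] [Module A V]
  {W : Type w} [AddCommGroup W] [Module A W]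

/-- `P / Q` is free of rank one, for submodules `Q ≤ P`. -/
def FreeRankOneQuot (Q P : Submodule A V) : Prop :=
  Nonempty ((P ⧸ Q.submoduleOf P) ≃ₗ[A] A)

theorem FreeRankOneQuot.of_linearMap {Q P : Submodule A V} (φ : P →ₗ[A] A)
    (h1 : Function.Surjective φ) (h2 : ∀ x : P, φ x = 0 ↔ (x : V) ∈ Q) :
    FreeRankOneQuot Q P := by
  have hk : Q.submoduleOf P = LinearMap.ker φ := by
    ext x
    rw [LinearMap.mem_ker, h2]
    rfl
  unfold FreeRankOneQuot
  rw [hk]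
  exact ⟨φ.quotKerEquivOfSurjective h1⟩

theorem FreeRankOneQuot.map_iff {Q P : Submodule A V} (j : V →ₗ[A] W)
    (hj : Function.Injective j) :
    FreeRankOneQuot (Q.map j) (P.map j) ↔ FreeRankOneQuot Q P := by
  have e : (P ⧸ Q.submoduleOf P) ≃ₗ[A] (P.map j ⧸ (Q.map j).submoduleOf (P.map j)) := by
    refine Submodule.Quotient.equiv _ _ (P.equivMapOfInjective j hj) ?_
    ext ⟨y, hy⟩
    obtain ⟨x, hx, rfl⟩ := hy
    constructor
    · rintro ⟨z, hz, hzx⟩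
      have : j z.1 = j x := congrArg Subtype.val hzx
      exact ⟨z.1, hz, this⟩
    · rintro ⟨z, hz, hzx⟩
      have : z = x := hj hzx
      subst this
      exact ⟨⟨z, hx⟩, hz, rfl⟩
  exact ⟨fun ⟨f⟩ => ⟨e.trans f⟩, fun ⟨f⟩ => ⟨e.symm.trans f⟩⟩

variable (A V) in
/-- Full flags `0 = F₀ ⊂ F₁ ⊂ ⋯ ⊂ Fₙ = V` with every `Fᵢ / Fᵢ₋₁` free of rank one. -/
@[ext]
structure FullFlag (n : ℕ) where
  sub : Fin (n + 1) → Submodule A V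
  bot : sub 0 = ⊥
  top : sub (Fin.last n) = ⊤
  le : ∀ i : Fin n, sub i.castSucc ≤ sub i.succ
  free : ∀ i : Fin n, FreeRankOneQuot (sub i.castSucc) (sub i.succ)

/-- `L₁, …, Lₙ` are submodules, free of rank one, such that `⨁ Lᵢ → V` is an isomorphism. -/
structure IsSplitting {n : ℕ} (L : Fin n → Submodule A V) : Prop where
  free : ∀ i, Nonempty (L i ≃ₗ[A] A)
  internal : DirectSum.IsInternal L

/-- The set `[L]` of the full flags
`(0, L_{σ(1)}, L_{σ(1)} ⊕ L_{σ(2)}, …, L_{σ(1)} ⊕ ⋯ ⊕ L_{σ(n)})`, over all orderings `σ`.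
It depends only on the unordered set `{L₁, …, Lₙ}`. -/
def flagsOf {n : ℕ} (L : Fin n → Submodule A V) : Set (FullFlag A V n) :=
  {F | ∃ σ : Equiv.Perm (Fin n), ∀ k : Fin (n + 1),
    F.sub k = ⨆ (j : Fin n) (_ : j.castSucc < k), L (σ j)}

/-- Every full flag comes from a splitting. -/
theorem exists_splitting {n : ℕ} (F : FullFlag A V n) :
    ∃ L : Fin n → Submodule A V, IsSplitting L ∧ F ∈ flagsOf L := by
  classical
  have key : ∀ i : Fin n, ∃ x ∈ F.sub i.succ,
      F.sub i.succ ≤ F.sub i.castSucc ⊔ Submodule.span A {x} ∧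
      ∀ a : A, a • x ∈ F.sub i.castSucc → a = 0 := by
    intro i
    obtain ⟨e⟩ := F.free i
    obtain ⟨x, hx⟩ := Submodule.Quotient.mk_surjective _ (e.symm 1)
    refine ⟨x.1, x.2, ?_, ?_⟩
    · intro y hy
      have h1 : Submodule.Quotient.mk (p := (F.sub i.castSucc).submoduleOf (F.sub i.succ))
          (⟨y, hy⟩ - e (Submodule.Quotient.mk ⟨y, hy⟩) • x) = 0 := by
        apply e.injective
        rw [Submodule.Quotient.mk_sub, Submodule.Quotient.mk_smul, hx]
        simp
      rw [Submodule.Quotient.mk_eq_zero] at h1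
      have h2 : y - e (Submodule.Quotient.mk ⟨y, hy⟩) • x.1 ∈ F.sub i.castSucc := h1
      have := Submodule.add_mem_sup h2 (Submodule.smul_mem (Submodule.span A {x.1})
        (e (Submodule.Quotient.mk ⟨y, hy⟩)) (Submodule.mem_span_singleton_self x.1))
      simpa using this
    · intro a ha
      have h1 : Submodule.Quotient.mk (p := (F.sub i.castSucc).submoduleOf (F.sub i.succ))
          (a • x) = 0 := by
        rw [Submodule.Quotient.mk_eq_zero]
        exact ha
      rw [Submodule.Quotient.mk_smul, hx] at h1
      simpa using congrArg e h1
  choose x hx hgen hind using key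
  have hmono : Monotone F.sub := Fin.monotone_iff_le_succ.2 F.le
  have hlin : LinearIndependent A x := by
    rw [Fintype.linearIndependent_iff]
    intro g hg
    by_contra! hne
    obtain ⟨i, hi, hmax⟩ : ∃ i, g i ≠ 0 ∧ ∀ j, i < j → g j = 0 := by
      obtain ⟨i, hi⟩ := (Finset.univ.filter fun i => g i ≠ 0).exists_maximal
        (by obtain ⟨i, hi⟩ := hne; exact ⟨i, by simp [hi]⟩)
      refine ⟨i, by simpa using hi.1, fun j hj => ?_⟩
      by_contra hgj
      exact absurd (hi.2 (y := j) (by simp [hgj]) hj.le) (not_le.2 hj)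
    apply hi
    apply hind i
    rw [← Finset.add_sum_erase _ _ (Finset.mem_univ i)] at hg
    rw [eq_neg_of_add_eq_zero_left hg]
    refine Submodule.neg_mem _ (Submodule.sum_mem _ fun j hj => ?_)
    rcases lt_trichotomy j i with h | h | h
    · exact Submodule.smul_mem _ _ (hmono (Fin.succ_le_castSucc_iff.2 h) (hx j))
    · simp [h] at hj
    · simp [hmax j h]
  have hsup : ∀ k : Fin (n + 1),
      F.sub k = ⨆ (j : Fin n) (_ : j.castSucc < k), Submodule.span A {x j} := by
    intro k
    apply le_antisymm
    · induction k using Fin.induction with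
      | zero => simp [F.bot]
      | succ i ih =>
        refine (hgen i).trans (sup_le (ih.trans ?_) ?_)
        · exact iSup_mono fun j => iSup_mono' fun h => ⟨h.trans Fin.castSucc_lt_succ, le_rfl⟩
        · exact le_iSup₂_of_le i Fin.castSucc_lt_succ le_rfl
    · refine iSup₂_le fun j hj => ?_
      rw [Submodule.span_singleton_le_iff_mem]
      exact hmono (Fin.castSucc_lt_iff_succ_le.1 hj) (hx j)
  refine ⟨fun i => Submodule.span A {x i}, ⟨fun i => ?_, ?_⟩, 1, fun k => hsup k⟩
  · have hinj : Function.Injective (LinearMap.toSpanSingleton A V (x i)) := by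
      rw [← LinearMap.ker_eq_bot, LinearMap.ker_eq_bot']
      intro a ha
      apply hind i a
      rw [LinearMap.toSpanSingleton_apply] at ha
      rw [ha]
      exact zero_mem _
    have := LinearEquiv.ofInjective _ hinj
    rw [LinearMap.range_toSpanSingleton] at this
    exact ⟨this.symm⟩
  · rw [DirectSum.isInternal_submodule_iff_iSupIndep_and_iSup_eq_top]
    refine ⟨hlin.iSupIndep_span_singleton, ?_⟩
    rw [← F.top, hsup (Fin.last n)]
    simp [Fin.castSucc_lt_last]

variable (A V) in
/-- The simplicial complex `𝔽𝕃(V)`, `V` of rank `n`: its vertices are the full flags, its simplices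
the finite nonempty subsets of the sets `[L]`, for `L` a splitting of `V`. -/
def FL (n : ℕ) : AbstractSimplicialComplex (FullFlag A V n) where
  faces := {s | s.Nonempty ∧ ∃ L : Fin n → Submodule A V, IsSplitting L ∧ ∀ F ∈ s, F ∈ flagsOf L}
  isRelLowerSet_faces := by
    rintro s ⟨hs, L, hL, h⟩
    exact ⟨hs, fun t hts ht => ⟨ht, L, hL, fun F hF => h F (hts hF)⟩⟩
  singleton_mem F := by
    obtain ⟨L, hL, h⟩ := exists_splitting F
    exact ⟨Finset.singleton_nonempty F, L, hL, by simpa using h⟩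

/-- The image `gF = (gF₀, …, gFₙ)` of a full flag under an automorphism `g`. -/
def FullFlag.act {n : ℕ} (g : V ≃ₗ[A] V) (F : FullFlag A V n) : FullFlag A V n where
  sub k := (F.sub k).map g.toLinearMap
  bot := by rw [F.bot, Submodule.map_bot]
  top := by rw [F.top, Submodule.map_top, LinearEquiv.range]
  le i := Submodule.map_mono (F.le i)
  free i := (FreeRankOneQuot.map_iff g.toLinearMap g.injective).2 (F.free i)

theorem IsSplitting.map {n : ℕ} {L : Fin n → Submodule A V} (hL : IsSplitting L)
    (g : V ≃ₗ[A] V) : IsSplitting fun i => (L i).map g.toLinearMap := by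
  refine ⟨fun i => ?_, ?_⟩
  · obtain ⟨e⟩ := hL.free i
    exact ⟨((L i).equivMapOfInjective g.toLinearMap g.injective).symm.trans e⟩
  · have h := hL.internal
    rw [DirectSum.isInternal_submodule_iff_iSupIndep_and_iSup_eq_top] at h ⊢
    refine ⟨?_, ?_⟩
    · exact h.1.map_orderIso (Submodule.orderIsoMapComap g)
    · rw [← Submodule.map_iSup, h.2, Submodule.map_top, LinearEquiv.range]

/-- The simplicial automorphism of `𝔽𝕃(V)` given by an automorphism `g` of `V`. -/
def FLact {n : ℕ} (g : V ≃ₗ[A] V) : SimplicialMap (FL A V n) (FL A V n) where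
  toFun := FullFlag.act g
  map_face := by
    classical
    rintro s ⟨hs, L, hL, h⟩
    refine ⟨s.image (FullFlag.act g), ⟨hs.image _, _, hL.map g, ?_⟩,
      fun F hF => Finset.mem_image_of_mem _ hF⟩
    intro F' hF'
    obtain ⟨F, hF, rfl⟩ := Finset.mem_image.1 hF'
    obtain ⟨σ, hσ⟩ := h F hF
    refine ⟨σ, fun k => ?_⟩
    simp only [FullFlag.act, hσ k, Submodule.map_iSup]

end Flags

/-! ## The free modules `Aⁿ`, their inclusions and elementary automorphisms -/

section Standard

variable (A : Type u) [Ring A]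

/-- The inclusion `Aⁿ → Aⁿ⁺¹`, `(a₁, …, aₙ) ↦ (a₁, …, aₙ, 0)`. -/
def inclSucc (n : ℕ) : (Fin n → A) →ₗ[A] (Fin (n + 1) → A) where
  toFun x := Fin.snoc (α := fun _ => A) x 0
  map_add' x y := by
    ext i
    refine Fin.lastCases ?_ (fun i => ?_) i <;> simp
  map_smul' a x := by
    ext i
    refine Fin.lastCases ?_ (fun i => ?_) i <;> simp

/-- The inclusion `Aⁿ → A^∞`, `(a₁, …, aₙ) ↦ (a₁, …, aₙ, 0, 0, …)`; here `A^∞` is `ℕ →₀ A`. -/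
def inclInf (n : ℕ) : (Fin n → A) →ₗ[A] (ℕ →₀ A) :=
  (Finsupp.lmapDomain A A (Fin.val : Fin n → ℕ)).comp
    (Finsupp.linearEquivFunOnFinite A A (Fin n)).symm.toLinearMap

/-- The submodule `Aⁿ` of `A^∞`. -/
def stdSub (n : ℕ) : Submodule A (ℕ →₀ A) := LinearMap.range (inclInf A n)

/-- The elementary automorphism `x ↦ x + xᵢ a eⱼ` of the left `A`-module `Aⁿ`, that is, right
multiplication of row vectors by the elementary matrix `1 + a Eᵢⱼ`, for `i ≠ j`. -/
def elemAut {n : ℕ} {i j : Fin n} (h : i ≠ j) (a : A) : (Fin n → A) ≃ₗ[A] (Fin n → A) :=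
  LinearEquiv.transvection (f := LinearMap.proj i) (v := Pi.single j a) (by simp [h])

/-- The subgroup `Eₙ(A)` of `GLₙ(A) = Aut(Aⁿ)` generated by the elementary matrices. -/
def elementaryGroup (n : ℕ) : Subgroup ((Fin n → A) ≃ₗ[A] (Fin n → A)) :=
  Subgroup.closure {g | ∃ (i j : Fin n) (h : i ≠ j) (a : A), g = elemAut A h a}

/-- The elementary automorphism `x ↦ x + xᵢ a eⱼ` of `A^∞`, for `i ≠ j`. -/
def elemAutInf {i j : ℕ} (h : i ≠ j) (a : A) : (ℕ →₀ A) ≃ₗ[A] (ℕ →₀ A) :=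
  LinearEquiv.transvection (f := Finsupp.lapply i) (v := Finsupp.single j a) (by simp [h.symm])

/-- The group `E(A)` generated by the elementary automorphisms of `A^∞`. -/
def elementaryGroupInf : Subgroup ((ℕ →₀ A) ≃ₗ[A] (ℕ →₀ A)) :=
  Subgroup.closure {g | ∃ (i j : ℕ) (h : i ≠ j) (a : A), g = elemAutInf A h a}

variable {A}

@[simp] theorem inclSucc_castSucc {n : ℕ} (x : Fin n → A) (i : Fin n) :
    inclSucc A n x i.castSucc = x i := by
  simp [inclSucc]

@[simp] theorem inclSucc_last {n : ℕ} (x : Fin n → A) :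
    inclSucc A n x (Fin.last n) = 0 := by
  simp [inclSucc]

theorem inclSucc_injective (n : ℕ) : Function.Injective (inclSucc A n) := by
  intro x y h
  ext i
  simpa using congrFun h i.castSucc

theorem mem_range_inclSucc {n : ℕ} (x : Fin (n + 1) → A) :
    x ∈ LinearMap.range (inclSucc A n) ↔ x (Fin.last n) = 0 := by
  constructor
  · rintro ⟨y, rfl⟩
    simp
  · intro h
    refine ⟨fun i => x i.castSucc, ?_⟩
    ext i
    refine Fin.lastCases ?_ (fun i => ?_) i <;> simp [h]

theorem inclInf_apply_lt {n : ℕ} (x : Fin n → A) (i : Fin n) : inclInf A n x i = x i := by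
  simp only [inclInf, LinearMap.comp_apply, Finsupp.lmapDomain_apply]
  rw [Finsupp.mapDomain_apply Fin.val_injective]
  rfl

theorem inclInf_apply_ge {n : ℕ} (x : Fin n → A) {m : ℕ} (h : n ≤ m) : inclInf A n x m = 0 := by
  simp only [inclInf, LinearMap.comp_apply, Finsupp.lmapDomain_apply]
  apply Finsupp.mapDomain_of_notMem_range
  rintro ⟨i, rfl⟩
  exact absurd i.2 (not_lt.2 h)

theorem inclInf_injective (n : ℕ) : Function.Injective (inclInf A n) := by
  intro x y h
  ext i
  rw [← inclInf_apply_lt x, h, inclInf_apply_lt]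

theorem mem_stdSub {n : ℕ} (x : ℕ →₀ A) : x ∈ stdSub A n ↔ ∀ m, n ≤ m → x m = 0 := by
  constructor
  · rintro ⟨y, rfl⟩ m hm
    exact inclInf_apply_ge y hm
  · intro h
    refine ⟨fun i => x i, ?_⟩
    ext m
    by_cases hm : m < n
    · exact inclInf_apply_lt (fun i : Fin n => x i) ⟨m, hm⟩
    · rw [inclInf_apply_ge _ (not_lt.1 hm), h m (not_lt.1 hm)]

theorem stdSub_mono {m n : ℕ} (h : m ≤ n) : stdSub A m ≤ stdSub A n := by
  intro x hx
  rw [mem_stdSub] at hx ⊢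
  exact fun k hk => hx k (h.trans hk)

theorem stdSub_free (n : ℕ) : FreeRankOneQuot (stdSub A n) (stdSub A (n + 1)) := by
  refine .of_linearMap ((Finsupp.lapply n).comp (stdSub A (n + 1)).subtype) ?_ ?_
  · intro a
    refine ⟨⟨Finsupp.single n a, ?_⟩, by simp⟩
    rw [mem_stdSub]
    intro m hm
    rw [Finsupp.single_eq_of_ne (by omega)]
  · rintro ⟨x, hx⟩
    rw [mem_stdSub] at hx
    rw [mem_stdSub]
    simp only [LinearMap.comp_apply, Submodule.subtype_apply, Finsupp.lapply_apply]
    constructor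
    · intro h m hm
      rcases hm.eq_or_lt with rfl | h'
      · exact h
      · exact hx m h'
    · exact fun h => h n le_rfl

/-! ## The inclusion `𝔽𝕃(Aⁿ) → 𝔽𝕃(Aⁿ⁺¹)` -/

/-- The flag `(F₀, …, Fₙ, Aⁿ⁺¹)` of `Aⁿ⁺¹`, for a flag `F` of `Aⁿ`. -/
def FullFlag.extend {n : ℕ} (F : FullFlag A (Fin n → A) n) :
    FullFlag A (Fin (n + 1) → A) (n + 1) where
  sub := Fin.snoc (α := fun _ => Submodule A (Fin (n + 1) → A))
    (fun k => (F.sub k).map (inclSucc A n)) ⊤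
  bot := by
    rw [← Fin.castSucc_zero, Fin.snoc_castSucc, F.bot, Submodule.map_bot]
  top := by rw [Fin.snoc_last]
  le i := by
    refine Fin.lastCases ?_ (fun i => ?_) i
    · rw [Fin.succ_last, Fin.snoc_last]
      exact le_top
    · rw [Fin.snoc_castSucc, Fin.succ_castSucc, Fin.snoc_castSucc]
      exact Submodule.map_mono (F.le i)
  free i := by
    refine Fin.lastCases ?_ (fun i => ?_) i
    · rw [Fin.succ_last, Fin.snoc_last, Fin.snoc_castSucc, F.top, Submodule.map_top]
      refine .of_linearMap ((LinearMap.proj (Fin.last n)).comp (Submodule.subtype _)) ?_ ?_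
      · intro a
        exact ⟨⟨Pi.single (Fin.last n) a, trivial⟩, by simp⟩
      · intro x
        rw [mem_range_inclSucc]
        rfl
    · rw [Fin.snoc_castSucc, Fin.succ_castSucc, Fin.snoc_castSucc]
      exact (FreeRankOneQuot.map_iff _ (inclSucc_injective n)).2 (F.free i)

theorem iSupIndep_iff_sum_univ {V : Type v} [AddCommGroup V] [Module A V] {n : ℕ}
    (p : Fin n → Submodule A V) :
    iSupIndep p ↔ ∀ x : Fin n → V, (∀ i, x i ∈ p i) → ∑ i, x i = 0 → ∀ i, x i = 0 := by
  classical
  rw [iSupIndep_iff_finsetSum_eq_zero_imp_eq_zero]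
  constructor
  · intro h x hx h0 i
    exact h Finset.univ x (fun i _ => hx i) h0 i (Finset.mem_univ i)
  · intro h s x hx h0 i hi
    have := h (fun i => if i ∈ s then x i else 0) ?_ ?_ i
    · simpa [hi] using this
    · intro i
      by_cases hi : i ∈ s <;> simp [hi, hx]
    · simpa using h0

/-- A splitting of `Aⁿ` and the last coordinate line form a splitting of `Aⁿ⁺¹`. -/
theorem IsSplitting.extend {n : ℕ} {L : Fin n → Submodule A (Fin n → A)} (hL : IsSplitting L) :
    IsSplitting (Fin.snoc (α := fun _ => Submodule A (Fin (n + 1) → A))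
      (fun i => (L i).map (inclSucc A n))
      (LinearMap.range (LinearMap.single A (fun _ : Fin (n + 1) => A) (Fin.last n)))) := by
  have h := hL.internal
  rw [DirectSum.isInternal_submodule_iff_iSupIndep_and_iSup_eq_top] at h
  refine ⟨fun i => ?_, ?_⟩
  · refine Fin.lastCases ?_ (fun i => ?_) i
    · rw [Fin.snoc_last]
      have hinj : Function.Injective
          (LinearMap.single A (fun _ : Fin (n + 1) => A) (Fin.last n)) :=
        fun a b hab => Pi.single_injective (Fin.last n) hab
      exact ⟨(LinearEquiv.ofInjective _ hinj).symm⟩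
    · rw [Fin.snoc_castSucc]
      obtain ⟨e⟩ := hL.free i
      exact ⟨((L i).equivMapOfInjective _ (inclSucc_injective n)).symm.trans e⟩
  · rw [DirectSum.isInternal_submodule_iff_iSupIndep_and_iSup_eq_top]
    constructor
    · rw [iSupIndep_iff_sum_univ]
      intro x hx hsum
      have h1 : ∀ i : Fin n, ∃ y ∈ L i, inclSucc A n y = x i.castSucc := by
        intro i
        have := hx i.castSucc
        rw [Fin.snoc_castSucc] at this
        exact this
      choose y hy hyx using h1
      obtain ⟨a, ha⟩ : ∃ a, Pi.single (Fin.last n) a = x (Fin.last n) := by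
        have := hx (Fin.last n)
        rw [Fin.snoc_last] at this
        exact this
      rw [Fin.sum_univ_castSucc] at hsum
      simp_rw [← hyx] at hsum
      rw [← map_sum, ← ha] at hsum
      have ha0 : a = 0 := by simpa using congrFun hsum (Fin.last n)
      rw [ha0, Pi.single_zero, add_zero] at hsum
      have hy0 := (iSupIndep_iff_sum_univ L).1 h.1 y hy
        (inclSucc_injective n (hsum.trans (map_zero _).symm))
      intro i
      refine Fin.lastCases ?_ (fun i => ?_) i
      · rw [← ha, ha0, Pi.single_zero]
      · rw [← hyx, hy0, map_zero]
    · refine eq_top_iff.2 fun x _ => ?_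
      have hx : x - Pi.single (Fin.last n) (x (Fin.last n)) ∈ LinearMap.range (inclSucc A n) := by
        rw [mem_range_inclSucc]
        simp
      obtain ⟨y, hy⟩ := hx
      rw [← sub_add_cancel x (Pi.single (Fin.last n) (x (Fin.last n))), ← hy]
      refine Submodule.add_mem _ ?_ ?_
      · have hy' : y ∈ ⨆ i, L i := by rw [h.2]; trivial
        have := Submodule.mem_map_of_mem (f := inclSucc A n) hy'
        rw [Submodule.map_iSup] at this
        refine (iSup_le fun i => ?_ : (⨆ i, (L i).map (inclSucc A n)) ≤ _) this
        refine le_iSup_of_le i.castSucc ?_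
        rw [Fin.snoc_castSucc]
      · refine Submodule.mem_iSup_of_mem (Fin.last n) ?_
        rw [Fin.snoc_last]
        exact ⟨x (Fin.last n), rfl⟩

/-- The inclusion `𝔽𝕃(Aⁿ) → 𝔽𝕃(Aⁿ⁺¹)`. -/
def FLincl (A : Type u) [Ring A] (n : ℕ) :
    SimplicialMap (FL A (Fin n → A) n) (FL A (Fin (n + 1) → A) (n + 1)) where
  toFun := FullFlag.extend
  map_face := by
    classical
    rintro s ⟨hs, L, hL, h⟩
    refine ⟨s.image FullFlag.extend, ⟨hs.image _, _, hL.extend, ?_⟩,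
      fun F hF => Finset.mem_image_of_mem _ hF⟩
    intro F' hF'
    obtain ⟨F, hF, rfl⟩ := Finset.mem_image.1 hF'
    obtain ⟨σ, hσ⟩ := h F hF
    have key : ∃ τ : Equiv.Perm (Fin (n + 1)), (∀ i : Fin n, τ i.castSucc = (σ i).castSucc) ∧
        τ (Fin.last n) = Fin.last n := by
      refine ⟨finSuccEquivLast.trans (σ.optionCongr.trans finSuccEquivLast.symm), ?_, ?_⟩ <;>
        simp
    obtain ⟨τ, h1, h2⟩ := key
    refine ⟨τ, fun k => ?_⟩
    refine Fin.lastCases ?_ (fun k => ?_) k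
    · rw [FullFlag.top]
      have := (DirectSum.isInternal_submodule_iff_iSupIndep_and_iSup_eq_top _).1
        hL.extend.internal
      rw [← this.2, ← τ.iSup_comp]
      simp [Fin.castSucc_lt_last]
    · simp only [FullFlag.extend, Fin.snoc_castSucc, hσ k, Submodule.map_iSup]
      apply le_antisymm
      · refine iSup₂_le fun j hj => le_iSup₂_of_le j.castSucc (by simpa using hj) ?_
        rw [h1, Fin.snoc_castSucc]
      · refine iSup₂_le fun j => ?_
        refine Fin.lastCases ?_ (fun j => ?_) j
        · intro hj
          exact absurd hj (by simp [Fin.le_last])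
        · intro hj
          refine le_iSup₂_of_le j (by simpa using hj) ?_
          rw [h1, Fin.snoc_castSucc]

/-! ## The infinite flag complex and the stable general linear group -/

variable (A) in
/-- Flags `0 = V₀ ⊂ V₁ ⊂ V₂ ⊂ ⋯ ⊂ A^∞` with every `Vᵢ / Vᵢ₋₁` free of rank one and with `Vₙ = Aⁿ`
for all sufficiently large `n`. -/
@[ext]
structure InfFlag where
  sub : ℕ → Submodule A (ℕ →₀ A)
  bot : sub 0 = ⊥
  le : ∀ i, sub i ≤ sub (i + 1)
  free : ∀ i, FreeRankOneQuot (sub i) (sub (i + 1))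
  eventually_std : ∃ N, ∀ n, N ≤ n → sub n = stdSub A n

/-- The flag `(F₀, …, Fₙ = Aⁿ, Aⁿ⁺¹, Aⁿ⁺², …)` of `A^∞`, for a flag `F` of `Aⁿ`. -/
def FullFlag.toInf {n : ℕ} (F : FullFlag A (Fin n → A) n) : InfFlag A where
  sub k := if h : k < n + 1 then (F.sub ⟨k, h⟩).map (inclInf A n) else stdSub A k
  bot := by
    rw [dif_pos (Nat.succ_pos n)]
    exact (congrArg _ F.bot).trans (Submodule.map_bot _)
  le i := by
    rcases lt_trichotomy i n with hi | rfl | hi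
    · rw [dif_pos (by omega), dif_pos (by omega)]
      exact Submodule.map_mono (F.le ⟨i, hi⟩)
    · rw [dif_pos (by omega), dif_neg (by omega)]
      exact LinearMap.map_le_range.trans (stdSub_mono (Nat.le_succ i))
    · rw [dif_neg (by omega), dif_neg (by omega)]
      exact stdSub_mono (Nat.le_succ i)
  free i := by
    rcases lt_trichotomy i n with hi | rfl | hi
    · rw [dif_pos (by omega), dif_pos (by omega)]
      exact (FreeRankOneQuot.map_iff _ (inclInf_injective n)).2 (F.free ⟨i, hi⟩)
    · rw [dif_pos (by omega), dif_neg (by omega)]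
      have h : (F.sub ⟨i, Nat.lt_succ_self i⟩).map (inclInf A i) = stdSub A i :=
        (congrArg _ F.top).trans (Submodule.map_top _)
      rw [h]
      exact stdSub_free i
    · rw [dif_neg (by omega), dif_neg (by omega)]
      exact stdSub_free i
  eventually_std := ⟨n + 1, fun k hk => dif_neg (not_lt.2 hk)⟩

/-- Every flag of `A^∞` comes from a flag of some `Aⁿ`. -/
theorem exists_toInf (F : InfFlag A) :
    ∃ (n : ℕ) (F' : FullFlag A (Fin n → A) n), F'.toInf = F := by
  obtain ⟨N, hN⟩ := F.eventually_std
  have hmono : Monotone F.sub := monotone_nat_of_le_succ F.le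
  have hmap : ∀ k, k ≤ N → ((F.sub k).comap (inclInf A N)).map (inclInf A N) = F.sub k := by
    intro k hk
    rw [Submodule.map_comap_eq]
    refine inf_eq_right.2 ((hmono hk).trans ?_)
    rw [hN N le_rfl]
    exact le_rfl
  refine ⟨N, ⟨fun k => (F.sub k).comap (inclInf A N), ?_, ?_, ?_, ?_⟩, ?_⟩
  · rw [Fin.val_zero, F.bot, Submodule.comap_bot, LinearMap.ker_eq_bot]
    exact inclInf_injective N
  · rw [Fin.val_last, hN N le_rfl]
    exact eq_top_iff.2 fun x _ => ⟨x, rfl⟩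
  · intro i
    exact Submodule.comap_mono (F.le i)
  · intro i
    rw [← FreeRankOneQuot.map_iff _ (inclInf_injective N), hmap _ (by simp [i.2.le]),
      hmap _ (by simp)]
    exact F.free i
  · ext1
    funext k
    by_cases hk : k < N + 1
    · exact (dif_pos hk).trans (hmap k (by omega))
    · exact (dif_neg hk).trans (hN k (by omega)).symm

variable (A) in
/-- The simplicial complex `𝔽𝕃(A^∞)`: a finite nonempty set of flags is a simplex if, for some `n`,
it comes from a simplex of `𝔽𝕃(Aⁿ)`. -/
def FLinf : AbstractSimplicialComplex (InfFlag A) where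
  faces := {s | s.Nonempty ∧ ∃ n, ∃ t ∈ (FL A (Fin n → A) n).faces,
    ∀ F ∈ s, ∃ F' ∈ t, F'.toInf = F}
  isRelLowerSet_faces := by
    rintro s ⟨hs, n, t, ht, h⟩
    exact ⟨hs, fun s' hs' hne => ⟨hne, n, t, ht, fun F hF => h F (hs' hF)⟩⟩
  singleton_mem F := by
    obtain ⟨n, F', rfl⟩ := exists_toInf F
    exact ⟨Finset.singleton_nonempty _, n, {F'}, (FL A (Fin n → A) n).singleton_mem F',
      by simp⟩

theorem single_mem_stdSub {m n : ℕ} (h : m < n) (a : A) : Finsupp.single m a ∈ stdSub A n := by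
  rw [mem_stdSub]
  intro k hk
  rw [Finsupp.single_eq_of_ne (by omega)]

theorem stdSub_succ (n : ℕ) :
    stdSub A (n + 1) = stdSub A n ⊔ Submodule.span A {Finsupp.single n 1} := by
  apply le_antisymm
  · intro x hx
    rw [mem_stdSub] at hx
    rw [← sub_add_cancel x (Finsupp.single n (x n))]
    refine Submodule.add_mem_sup ?_ ?_
    · rw [mem_stdSub]
      intro m hm
      rcases hm.eq_or_lt with rfl | h
      · simp
      · simp [hx m h, Finsupp.single_eq_of_ne h.ne']
    · rw [Submodule.mem_span_singleton]
      exact ⟨x n, by simp⟩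
  · refine sup_le (stdSub_mono n.le_succ) ?_
    rw [Submodule.span_singleton_le_iff_mem]
    exact single_mem_stdSub n.lt_succ_self 1

/-- `g` lies in the image of `GL_N(A)`: it preserves `A^N` and fixes the basis vectors `e_m`,
`m ≥ N` (the basis being indexed from `0`). -/
def StableAt (N : ℕ) (g : (ℕ →₀ A) ≃ₗ[A] (ℕ →₀ A)) : Prop :=
  (stdSub A N).map g.toLinearMap = stdSub A N ∧
    ∀ m, N ≤ m → g (Finsupp.single m 1) = Finsupp.single m 1

theorem StableAt.mono {M N : ℕ} (h : M ≤ N) {g : (ℕ →₀ A) ≃ₗ[A] (ℕ →₀ A)} (hg : StableAt M g) :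
    StableAt N g := by
  refine ⟨?_, fun m hm => hg.2 m (h.trans hm)⟩
  induction N, h using Nat.le_induction with
  | base => exact hg.1
  | succ n hn ih =>
    rw [stdSub_succ, Submodule.map_sup, ih, Submodule.map_span, Set.image_singleton]
    congr 3
    exact hg.2 n hn

variable (A) in
/-- The group `GL(A) ⊂ Aut(A^∞)`, the union of the images of the groups `GLₙ(A)`. -/
def GLinf : Subgroup ((ℕ →₀ A) ≃ₗ[A] (ℕ →₀ A)) where
  carrier := {g | ∃ N, StableAt N g}
  mul_mem' := by
    rintro g g' ⟨M, hM⟩ ⟨N, hN⟩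
    have h1 := hM.mono (le_max_left M N)
    have h2 := hN.mono (le_max_right M N)
    refine ⟨max M N, ?_, fun m hm => ?_⟩
    · have : (g * g').toLinearMap = g.toLinearMap.comp g'.toLinearMap := rfl
      rw [this, Submodule.map_comp, h2.1, h1.1]
    · rw [LinearEquiv.mul_apply, h2.2 m hm, h1.2 m hm]
  one_mem' := ⟨0, Submodule.map_id _, fun _ _ => rfl⟩
  inv_mem' := by
    rintro g ⟨N, hN⟩
    refine ⟨N, ?_, fun m hm => ?_⟩
    · have : (g⁻¹).toLinearMap.comp g.toLinearMap = LinearMap.id := by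
        ext1 x
        exact LinearMap.ext fun y => g.symm_apply_apply _
      conv_lhs => rw [← hN.1]
      rw [← Submodule.map_comp, this, Submodule.map_id]
    · exact g.symm_apply_eq.2 (hN.2 m hm).symm

/-- `E(A)` is a subgroup of `GL(A)`. -/
theorem elementaryGroupInf_le : elementaryGroupInf A ≤ GLinf A := by
  refine (Subgroup.closure_le _).2 ?_
  rintro g ⟨i, j, h, a, rfl⟩
  have hle : ∀ (h' : i ≠ j) (b : A), ∀ x ∈ stdSub A (max i j + 1),
      elemAutInf A h' b x ∈ stdSub A (max i j + 1) := fun h' b x hx =>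
    Submodule.add_mem _ hx (Submodule.smul_mem _ _ (single_mem_stdSub (by omega) b))
  have hinv : ∀ x, elemAutInf A h a (elemAutInf A h (-a) x) = x := by
    intro x
    simp [elemAutInf, LinearMap.transvection, h]
  refine ⟨max i j + 1, le_antisymm ?_ ?_, fun m hm => ?_⟩
  · rintro _ ⟨x, hx, rfl⟩
    exact hle h a x hx
  · intro x hx
    exact ⟨_, hle h (-a) x hx, hinv x⟩
  · have : m ≠ i := by omega
    simp [elemAutInf, LinearMap.transvection, Finsupp.single_eq_of_ne this.symm]

/-- The image `gF = (gF₀, gF₁, …)` of a flag of `A^∞` under `g ∈ GL(A)`. -/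
def InfFlag.act (g : GLinf A) (F : InfFlag A) : InfFlag A where
  sub k := (F.sub k).map g.1.toLinearMap
  bot := by rw [F.bot, Submodule.map_bot]
  le i := Submodule.map_mono (F.le i)
  free i := (FreeRankOneQuot.map_iff g.1.toLinearMap g.1.injective).2 (F.free i)
  eventually_std := by
    obtain ⟨M, hM⟩ := g.2
    obtain ⟨N, hN⟩ := F.eventually_std
    refine ⟨max M N, fun n hn => ?_⟩
    rw [hN n ((le_max_right M N).trans hn)]
    exact (hM.mono ((le_max_left M N).trans hn)).1

theorem inclInf_inclSucc {n : ℕ} (x : Fin n → A) :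
    inclInf A (n + 1) (inclSucc A n x) = inclInf A n x := by
  ext m
  by_cases hm : m < n
  · have h1 := inclInf_apply_lt (inclSucc A n x) (Fin.castSucc ⟨m, hm⟩)
    have h2 := inclInf_apply_lt x ⟨m, hm⟩
    rw [inclSucc_castSucc] at h1
    exact h1.trans h2.symm
  · rw [inclInf_apply_ge x (not_lt.1 hm)]
    by_cases hm' : m = n
    · subst hm'
      have h1 := inclInf_apply_lt (inclSucc A m x) (Fin.last m)
      rwa [inclSucc_last] at h1
    · rw [inclInf_apply_ge _ (by omega)]

theorem FullFlag.extend_toInf {n : ℕ} (F : FullFlag A (Fin n → A) n) :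
    F.extend.toInf = F.toInf := by
  ext1
  funext k
  have hcomp : (inclInf A (n + 1)).comp (inclSucc A n) = inclInf A n :=
    LinearMap.ext fun x => inclInf_inclSucc x
  simp only [FullFlag.toInf, FullFlag.extend]
  rcases lt_trichotomy k (n + 1) with hk | rfl | hk
  · rw [dif_pos (by omega), dif_pos hk]
    have : (⟨k, by omega⟩ : Fin (n + 1 + 1)) = Fin.castSucc ⟨k, hk⟩ := rfl
    rw [this, Fin.snoc_castSucc, ← Submodule.map_comp, hcomp]
  · rw [dif_pos (by omega), dif_neg (by omega)]
    have : (⟨n + 1, by omega⟩ : Fin (n + 1 + 1)) = Fin.last (n + 1) := rfl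
    rw [this, Fin.snoc_last, Submodule.map_top]
    rfl
  · rw [dif_neg (by omega), dif_neg (by omega)]

theorem exists_face_of_le {m n : ℕ} (h : m ≤ n) {t : Finset (FullFlag A (Fin m → A) m)}
    (ht : t ∈ (FL A (Fin m → A) m).faces) :
    ∃ t' ∈ (FL A (Fin n → A) n).faces, ∀ F ∈ t, ∃ F' ∈ t', F'.toInf = F.toInf := by
  induction n, h using Nat.le_induction with
  | base => exact ⟨t, ht, fun F hF => ⟨F, hF, rfl⟩⟩
  | succ n _ ih =>
    obtain ⟨t', ht', h'⟩ := ih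
    obtain ⟨t'', ht'', h''⟩ := (FLincl A n).map_face t' ht'
    refine ⟨t'', ht'', fun F hF => ?_⟩
    obtain ⟨F', hF', e⟩ := h' F hF
    exact ⟨_, h'' F' hF', F'.extend_toInf.trans e⟩

theorem StableAt.exists_restrict {n : ℕ} {g : (ℕ →₀ A) ≃ₗ[A] (ℕ →₀ A)} (hg : StableAt n g) :
    ∃ g' : (Fin n → A) ≃ₗ[A] (Fin n → A), ∀ x, inclInf A n (g' x) = g (inclInf A n x) := by
  let e : (Fin n → A) ≃ₗ[A] stdSub A n :=
    LinearEquiv.ofInjective (inclInf A n) (inclInf_injective n)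
  let f : stdSub A n ≃ₗ[A] stdSub A n := (g.submoduleMap (stdSub A n)).trans
    (LinearEquiv.ofEq _ _ hg.1)
  refine ⟨e.trans (f.trans e.symm), fun x => ?_⟩
  exact congrArg Subtype.val (e.apply_symm_apply (f (e x)))

/-- The simplicial automorphism of `𝔽𝕃(A^∞)` given by `g ∈ GL(A)`. -/
def FLinfAct (g : GLinf A) : SimplicialMap (FLinf A) (FLinf A) where
  toFun := InfFlag.act g
  map_face := by
    classical
    rintro s ⟨hs, n, t, ht, h⟩
    refine ⟨s.image (InfFlag.act g), ⟨hs.image _, ?_⟩, fun F hF => Finset.mem_image_of_mem _ hF⟩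
    obtain ⟨N, hN⟩ := g.2
    have hM := hN.mono (le_max_right n N)
    obtain ⟨t', ht', h'⟩ := exists_face_of_le (le_max_left n N) ht
    obtain ⟨g', hg'⟩ := hM.exists_restrict
    obtain ⟨t'', ht'', h''⟩ := (FLact g').map_face t' ht'
    refine ⟨max n N, t'', ht'', fun F hF => ?_⟩
    obtain ⟨F₀, hF₀, rfl⟩ := Finset.mem_image.1 hF
    obtain ⟨F₁, hF₁, rfl⟩ := h F₀ hF₀
    obtain ⟨F₂, hF₂, e⟩ := h' F₁ hF₁
    refine ⟨_, h'' F₂ hF₂, ?_⟩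
    rw [← e]
    ext1
    funext k
    have hcomp : (inclInf A (max n N)).comp g'.toLinearMap =
        g.1.toLinearMap.comp (inclInf A (max n N)) := LinearMap.ext hg'
    simp only [FLact, FullFlag.toInf, FullFlag.act, InfFlag.act]
    by_cases hk : k < max n N + 1
    · rw [dif_pos hk, dif_pos hk, ← Submodule.map_comp, ← Submodule.map_comp, hcomp]
    · rw [dif_neg hk, dif_neg hk, (hM.mono (by omega)).1]

end Standard

end FlagComplex

end

/-! Let `L` be the last coordinate line of `Aⁿ⁺¹`. A flag `F` of `Aⁿ` yields two flags of `Aⁿ⁺¹`: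
put `L` on top, giving `(F₀, …, Fₙ, Aⁿ⁺¹)`, or put it at the bottom, giving `(0, L, F₁ ⊕ L, …, Fₙ ⊕
L)`. If `F` is a flag of a splitting of `Aⁿ`, both results are flags of that splitting enlarged by
`L`. The two simplicial maps are therefore contiguous, hence homotopic, and induce the same map on
homology (`contiguous_FLincl_FLshift`).

An automorphism fixing `Aⁿ` pointwise fixes every flag of the first kind (`act_extend_of_fix`). One
inducing the identity on `Aⁿ⁺¹ / L` fixes every flag of the second kind (`act_shift_of_proj`).
Either type thus acts trivially on the image of `H_r(𝔽𝕃(Aⁿ))`. An elementary automorphism `x ↦ x +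
xᵢ a eⱼ` is of the first type if `i` is the last index and of the second if `j` is. Otherwise it is
a commutator of automorphisms of these two types (`elemAut_commutator`). This proves (i).

For (ii), chains are finite sums, so each homology class of `𝔽𝕃(A^∞)` comes from some `𝔽𝕃(Aⁿ)`, with
`n` as large as desired (`exists_FLtoInf_eq_of_le`). A given elementary automorphism then restricts
to `Aⁿ⁺¹`, and (i) applies. -/

noncomputable section

namespace FlagComplex

open CategoryTheory Limits MonoidalCategory Simplicial

/-! ### Contiguity and increasing unions in simplicial homology -/

section Homology

variable {α β γ : Type w} {K : AbstractSimplicialComplex α} {L : AbstractSimplicialComplex β}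
  {M : AbstractSimplicialComplex γ}

/-- The composition of simplicial maps. -/
def SimplicialMap.comp (g : SimplicialMap L M) (f : SimplicialMap K L) : SimplicialMap K M where
  toFun := g.toFun ∘ f.toFun
  map_face s hs := by
    obtain ⟨t, ht, h⟩ := f.map_face s hs
    obtain ⟨t', ht', h'⟩ := g.map_face t ht
    exact ⟨t', ht', fun x hx => h' _ (h x hx)⟩

/-- The map `k` need only agree with the composite on vertices, so factorizations of flag maps can
be checked one flag at a time. -/
theorem homologyMap_comp_apply (f : SimplicialMap K L) (g : SimplicialMap L M)
    (k : SimplicialMap K M) (h : ∀ v, k.toFun v = g.toFun (f.toFun v)) (r : ℕ)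
    (x : homology K r) : homologyMap k r x = homologyMap g r (homologyMap f r x) := by
  have hk : orderedSSetMap k = orderedSSetMap f ≫ orderedSSetMap g := by
    ext m x
    exact Subtype.ext (funext fun i => h _)
  unfold homologyMap
  rw [hk, SSet.homologyMap_comp]
  rfl

theorem homologyMap_eq_self (f : SimplicialMap K K) (h : ∀ v, f.toFun v = v) (r : ℕ)
    (x : homology K r) : homologyMap f r x = x := by
  have hf : orderedSSetMap f = 𝟙 _ := by
    ext m x
    exact Subtype.ext (funext fun i => h _)
  unfold homologyMap
  rw [hf, SSet.homologyMap_id]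
  rfl

/-- The vertex maps of `f` and `g` jointly carry every simplex into a simplex. -/
def Contiguous (f g : SimplicialMap K L) : Prop :=
  ∀ s ∈ K.faces, ∃ t ∈ L.faces, ∀ x ∈ s, f.toFun x ∈ t ∧ g.toFun x ∈ t

/-- Contiguous simplicial maps are homotopic. -/
def Contiguous.homotopy {f g : SimplicialMap K L} (h : Contiguous f g) :
    SSet.Homotopy (orderedSSetMap f) (orderedSSetMap g) where
  h :=
    -- A simplex of `Δ[1]` labels each position by 0 or 1, and the label selects `f` or `g` there.
    -- Contiguity puts all the resulting vertices in one simplex; since ordered simplices are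
    -- arbitrary tuples, no order condition arises.
    { app m := TypeCat.ofHom fun x =>
        ⟨fun i => if (SSet.stdSimplex.objEquiv x.2).toOrderHom i = 0 then f.toFun (x.1.1 i)
          else g.toFun (x.1.1 i), by
          obtain ⟨s, hs, hx⟩ := x.1.2
          obtain ⟨t, ht, hst⟩ := h s hs
          refine ⟨t, ht, fun i => ?_⟩
          dsimp only
          split_ifs
          · exact (hst _ (hx i)).1
          · exact (hst _ (hx i)).2⟩
      naturality := by
        intros
        rfl }
  h₀ := by
    ext m x
    exact Subtype.ext (funext fun i => (if_pos rfl :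
      (if (0 : Fin 2) = 0 then f.toFun (x.1 i) else g.toFun (x.1 i)) = f.toFun (x.1 i)))
  h₁ := by
    ext m x
    exact Subtype.ext (funext fun i => (if_neg one_ne_zero :
      (if (1 : Fin 2) = 0 then f.toFun (x.1 i) else g.toFun (x.1 i)) = g.toFun (x.1 i)))
  rel := by
    -- The homotopy is relative to the empty subcomplex.
    ext m ⟨⟨x, hx⟩, y⟩
    exact hx.elim

theorem Contiguous.homologyMap_eq {f g : SimplicialMap K L} (h : Contiguous f g) (r : ℕ) :
    homologyMap f r = homologyMap g r := by
  unfold homologyMap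
  rw [h.homotopy.congr_homologyMap]

/-- In degree `n` this is the map of copowers of `R` induced by `f` on `n`-simplices, and an
injection of index sets induces a monomorphism. -/
instance mono_chainComplexMap_f {k : Type u} [Ring k] {X Y : SSet.{w}} (f : X ⟶ Y) [Mono f]
    (R : ModuleCat.{w} k) (n : ℕ) : Mono ((SSet.chainComplexMap f R).f n) := by
  change Mono ((sigmaConst.obj R).map (f.app _))
  infer_instance

theorem mono_orderedSSetMap (f : SimplicialMap K L) (hf : Function.Injective f.toFun) :
    Mono (orderedSSetMap f) := by
  rw [NatTrans.mono_iff_mono_app]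
  intro m
  rw [mono_iff_injective]
  intro x y hxy
  exact Subtype.ext (funext fun i => hf (congrFun (congrArg Subtype.val hxy) i))

/-- If `X` is the union of the images of an increasing sequence of injective maps `X n ⟶ X`,
every homology class of `X` comes from some `X n`. -/
theorem exists_sSet_homologyMap_eq {k : Type u} [Ring k] {X : ℕ → SSet.{w}} {Y : SSet.{w}}
    (t : ∀ n, X n ⟶ X (n + 1)) (f : ∀ n, X n ⟶ Y) [∀ n, Mono (f n)] (hft : ∀ n, t n ≫ f (n + 1) = f n)
    (hf : ∀ (r : ℕ) (y : Y _⦋r⦌), ∃ n x, (f n).app _ x = y) (R : ModuleCat.{w} k) (r : ℕ)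
    (z : (Y.homology R r : ModuleCat.{w} k)) : ∃ n x, (SSet.homologyMap (f n) R r).hom x = z := by
  -- The `r`-chains of `Y` supported on the image of `X n`.
  let S : ℕ → Submodule k ((Y.chainComplex R).X r) := fun n =>
    LinearMap.range ((SSet.chainComplexMap (f n) R).f r).hom
  have hS : Monotone S := by
    refine monotone_nat_of_le_succ fun n => ?_
    rintro _ ⟨x, rfl⟩
    refine ⟨((SSet.chainComplexMap (t n) R).f r).hom x, ?_⟩
    have h : SSet.chainComplexMap (f n) R =
        SSet.chainComplexMap (t n) R ≫ SSet.chainComplexMap (f (n + 1)) R := by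
      rw [← hft n]
      exact Functor.map_comp _ _ _
    rw [h]
    rfl
  have htop : ⨆ n, S n = ⊤ := by
    -- It suffices that the quotient by the union vanishes, which is tested on the summand of each
    -- simplex; that simplex lies in some `X n`.
    rw [← Submodule.ker_mkQ (⨆ n, S n), LinearMap.ker_eq_top]
    have h0 : ModuleCat.ofHom (⨆ n, S n).mkQ = 0 := by
      apply SSet.chainComplex_hom_ext
      intro y
      obtain ⟨n, x, rfl⟩ := hf r y
      rw [← SSet.ι_chainComplexMap_f, comp_zero]
      ext a
      refine (Submodule.Quotient.mk_eq_zero _).2 (Submodule.mem_iSup_of_mem n ?_)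
      exact ⟨_, rfl⟩
    exact congrArg ModuleCat.Hom.hom h0
  obtain ⟨c, rfl⟩ := (ModuleCat.epi_iff_surjective ((Y.chainComplex R).homologyπ r)).1
    inferInstance z
  -- The supremum is directed, so the chain of a representing cycle already lies in a single `S n`.
  have hc : (Y.chainComplex R).iCycles r c ∈ ⨆ n, S n := htop ▸ Submodule.mem_top
  obtain ⟨n, x, hx⟩ := (Submodule.mem_iSup_of_directed S hS.directed_le).1 hc
  -- The lifted chain `x` is itself a cycle: its boundary maps to the zero boundary of `c`, and the
  -- chain map is injective in the next degree as well.
  have hinj := (ModuleCat.mono_iff_injective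
    ((SSet.chainComplexMap (f n) R).f ((ComplexShape.down ℕ).next r))).1 inferInstance
  have hd : (((X n).chainComplex R).d r ((ComplexShape.down ℕ).next r)) x = 0 := by
    apply hinj
    rw [map_zero]
    refine (ConcreteCategory.congr_hom ((SSet.chainComplexMap (f n) R).comm r _) x).symm.trans ?_
    refine (congrArg ((Y.chainComplex R).d r _) hx).trans ?_
    exact ConcreteCategory.congr_hom ((Y.chainComplex R).iCycles_d r _) c
  obtain ⟨c', hc'⟩ : ∃ c', ((X n).chainComplex R).iCycles r c' = x :=
    ⟨_, HomologicalComplex.i_cyclesMk ((X n).chainComplex R) x _ rfl hd⟩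
  refine ⟨n, ((X n).chainComplex R).homologyπ r c', ?_⟩
  refine (ConcreteCategory.congr_hom
    (HomologicalComplex.homologyπ_naturality (SSet.chainComplexMap (f n) R) r) c').trans ?_
  refine congrArg ((Y.chainComplex R).homologyπ r) ?_
  apply (ModuleCat.mono_iff_injective ((Y.chainComplex R).iCycles r)).1 inferInstance
  refine (ConcreteCategory.congr_hom
    (HomologicalComplex.cyclesMap_i (SSet.chainComplexMap (f n) R) r) c').trans ?_
  exact (congrArg ((SSet.chainComplexMap (f n) R).f r) hc').trans hx

/-- If `L` is the union of an increasing sequence of subcomplexes `K n`, every homology class of `L`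
comes from some `K n`. -/
theorem exists_homologyMap_eq {α : ℕ → Type w} {K : ∀ n, AbstractSimplicialComplex (α n)}
    (t : ∀ n, SimplicialMap (K n) (K (n + 1))) (f : ∀ n, SimplicialMap (K n) L)
    (hinj : ∀ n, Function.Injective (f n).toFun)
    (hft : ∀ n v, (f (n + 1)).toFun ((t n).toFun v) = (f n).toFun v)
    (hf : ∀ s ∈ L.faces, ∃ n, ∃ s' ∈ (K n).faces, ∀ v ∈ s, ∃ v' ∈ s', (f n).toFun v' = v)
    (r : ℕ) (z : homology L r) : ∃ n x, homologyMap (f n) r x = z := by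
  have := fun n => mono_orderedSSetMap (f n) (hinj n)
  refine exists_sSet_homologyMap_eq (R := ModuleCat.of ℤ (ULift.{w} ℤ)) (fun n => orderedSSetMap (t n)) (fun n => orderedSSetMap (f n))
    (fun n => ?_) (fun r y => ?_) r z
  · ext m x
    exact Subtype.ext (funext fun i => hft n _)
  · obtain ⟨s, hs, hy⟩ := y.2
    obtain ⟨n, s', hs', h⟩ := hf s hs
    choose v hv hvy using fun i => h _ (hy i)
    exact ⟨n, ⟨v, s', hs', hv⟩, Subtype.ext (funext hvy)⟩

end Homology

/-! ### Rank-one quotients under pullback -/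

section Flags

variable {A : Type u} [Ring A] {V : Type v} [AddCommGroup V] [Module A V]
  {W : Type w} [AddCommGroup W] [Module A W]

/-- Since `p` is surjective, the composite `p⁻¹P → P → P / Q ≅ A` is surjective, with kernel `p⁻¹Q`.
-/
theorem FreeRankOneQuot.comap {Q P : Submodule A V} (h : FreeRankOneQuot Q P) (p : W →ₗ[A] V)
    (hp : Function.Surjective p) : FreeRankOneQuot (Q.comap p) (P.comap p) := by
  obtain ⟨e⟩ := h
  refine .of_linearMap
    (e.toLinearMap ∘ₗ (Q.submoduleOf P).mkQ ∘ₗ p.restrict (p := P.comap p) (q := P) fun _ hx => hx)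
    ?_ ?_
  · refine e.surjective.comp ((Submodule.mkQ_surjective _).comp ?_)
    rintro ⟨y, hy⟩
    obtain ⟨x, rfl⟩ := hp y
    exact ⟨⟨x, hy⟩, rfl⟩
  · intro x
    simp only [LinearMap.comp_apply, LinearEquiv.coe_coe, LinearEquiv.map_eq_zero_iff,
      Submodule.mkQ_apply, Submodule.Quotient.mk_eq_zero]
    rfl

theorem FreeRankOneQuot.bot (P : Submodule A V) (e : P ≃ₗ[A] A) : FreeRankOneQuot ⊥ P :=
  .of_linearMap e.toLinearMap e.surjective (by simp)

end Flags

/-! ### The last line on top and at the bottom of a flag -/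

section Standard

variable (A : Type u) [Ring A]

/-- The projection `Aⁿ⁺¹ → Aⁿ`, `(a₁, …, aₙ₊₁) ↦ (a₁, …, aₙ)`. -/
def projInit (n : ℕ) : (Fin (n + 1) → A) →ₗ[A] (Fin n → A) := LinearMap.funLeft A A Fin.castSucc

/-- The last coordinate line of `Aⁿ⁺¹`. -/
def lastLine (n : ℕ) : Submodule A (Fin (n + 1) → A) :=
  LinearMap.range (LinearMap.single A (fun _ : Fin (n + 1) => A) (Fin.last n))

variable {A} {n : ℕ}

@[simp] theorem projInit_apply (x : Fin (n + 1) → A) (i : Fin n) :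
    projInit A n x i = x i.castSucc := rfl

theorem projInit_inclSucc (x : Fin n → A) : projInit A n (inclSucc A n x) = x := by
  ext i
  simp

theorem projInit_surjective : Function.Surjective (projInit A n) :=
  fun x => ⟨_, projInit_inclSucc x⟩

theorem ker_projInit : LinearMap.ker (projInit A n) = lastLine A n := by
  ext x
  constructor
  · intro hx
    refine ⟨x (Fin.last n), ?_⟩
    ext i
    refine Fin.lastCases (by simp) (fun i => ?_) i
    simpa [Pi.single_apply] using (congrFun hx i).symm
  · rintro ⟨a, rfl⟩
    ext i
    simp

/-- The inclusion is a section of the projection, whose kernel is the last line. This links the two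
views of a shifted flag: preimages, suited to invariance, and sums of lines, suited to splittings.
-/
theorem comap_projInit (P : Submodule A (Fin n → A)) :
    P.comap (projInit A n) = P.map (inclSucc A n) ⊔ lastLine A n := by
  have h : P = (P.map (inclSucc A n)).map (projInit A n) := by
    have hid : projInit A n ∘ₗ inclSucc A n = LinearMap.id := LinearMap.ext projInit_inclSucc
    rw [← Submodule.map_comp, hid, Submodule.map_id]
  conv_lhs => rw [h]
  rw [Submodule.comap_map_eq, ker_projInit]

theorem lastLine_equiv : Nonempty (lastLine A n ≃ₗ[A] A) :=
  ⟨(LinearEquiv.ofInjective (LinearMap.single A (fun _ : Fin (n + 1) => A) (Fin.last n))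
    fun _ _ h => Pi.single_injective (Fin.last n) h).symm⟩

/-- The flag `(0, L, F₁ ⊕ L, …, Fₙ ⊕ L)` of `Aⁿ⁺¹`, for a flag `F` of `Aⁿ` and `L` the last
coordinate line. -/
def FullFlag.shift (F : FullFlag A (Fin n → A) n) : FullFlag A (Fin (n + 1) → A) (n + 1) where
  -- `Fₖ ⊕ L` is encoded as the preimage of `Fₖ` under the projection along `L`; the entry `k = 0`
  -- of this family is `L` itself.
  sub := Fin.cons (α := fun _ => Submodule A (Fin (n + 1) → A)) ⊥
    (fun k => (F.sub k).comap (projInit A n))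
  bot := Fin.cons_zero _ _
  top := by rw [← Fin.succ_last, Fin.cons_succ, F.top, Submodule.comap_top]
  le i := by
    refine Fin.cases ?_ (fun i => ?_) i
    · rw [Fin.castSucc_zero, Fin.cons_zero]
      exact bot_le
    · rw [Fin.cons_succ, Fin.castSucc_succ, Fin.cons_succ]
      exact Submodule.comap_mono (F.le i)
  free i := by
    refine Fin.cases ?_ (fun i => ?_) i
    · rw [Fin.castSucc_zero, Fin.cons_zero, Fin.cons_succ, F.bot, Submodule.comap_bot,
        ker_projInit]
      exact .bot _ lastLine_equiv.some
    · rw [Fin.cons_succ, Fin.castSucc_succ, Fin.cons_succ]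
      exact (F.free i).comap _ projInit_surjective

/-- The splitting of `Aⁿ⁺¹` given by a splitting of `Aⁿ` and the last coordinate line. -/
def extendLines (L : Fin n → Submodule A (Fin n → A)) :
    Fin (n + 1) → Submodule A (Fin (n + 1) → A) :=
  Fin.snoc (α := fun _ => Submodule A (Fin (n + 1) → A)) (fun i => (L i).map (inclSucc A n))
    (lastLine A n)

@[simp] theorem extendLines_castSucc (L : Fin n → Submodule A (Fin n → A)) (i : Fin n) :
    extendLines L i.castSucc = (L i).map (inclSucc A n) := Fin.snoc_castSucc ..

@[simp] theorem extendLines_last (L : Fin n → Submodule A (Fin n → A)) :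
    extendLines L (Fin.last n) = lastLine A n := Fin.snoc_last ..

theorem isSplitting_extendLines {L : Fin n → Submodule A (Fin n → A)} (hL : IsSplitting L) :
    IsSplitting (extendLines L) := hL.extend

theorem iSup_extendLines_perm {L : Fin n → Submodule A (Fin n → A)} (hL : IsSplitting L)
    (τ : Equiv.Perm (Fin (n + 1))) :
    ⨆ (j : Fin (n + 1)) (_ : j.castSucc < Fin.last (n + 1)), extendLines L (τ j) = ⊤ := by
  have := (DirectSum.isInternal_submodule_iff_iSupIndep_and_iSup_eq_top _).1
    (isSplitting_extendLines hL).internal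
  rw [← this.2, ← τ.iSup_comp (g := extendLines L)]
  simp [Fin.castSucc_lt_last]

/-- The splitting is named explicitly because contiguity requires the same one for `F.extend` and
`F.shift`. -/
theorem extend_mem_flagsOf {L : Fin n → Submodule A (Fin n → A)} (hL : IsSplitting L)
    {F : FullFlag A (Fin n → A) n} (hF : F ∈ flagsOf L) :
    F.extend ∈ flagsOf (extendLines L) := by
  obtain ⟨σ, hσ⟩ := hF
  obtain ⟨τ, h1⟩ : ∃ τ : Equiv.Perm (Fin (n + 1)), ∀ i : Fin n, τ i.castSucc = (σ i).castSucc :=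
    ⟨finSuccEquivLast.trans (σ.optionCongr.trans finSuccEquivLast.symm), by simp⟩
  refine ⟨τ, fun k => ?_⟩
  refine Fin.lastCases ?_ (fun k => ?_) k
  · rw [FullFlag.top, iSup_extendLines_perm hL]
  · simp only [FullFlag.extend, Fin.snoc_castSucc, hσ k, Submodule.map_iSup]
    apply le_antisymm
    · refine iSup₂_le fun j hj => le_iSup₂_of_le j.castSucc (by simpa using hj) ?_
      rw [h1, extendLines_castSucc]
    · refine iSup₂_le fun j => ?_
      refine Fin.lastCases ?_ (fun j => ?_) j
      · intro hj
        exact absurd hj (by simp [Fin.le_last])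
      · intro hj
        refine le_iSup₂_of_le j (by simpa using hj) ?_
        rw [h1, extendLines_castSucc]

theorem shift_mem_flagsOf {L : Fin n → Submodule A (Fin n → A)}
    {F : FullFlag A (Fin n → A) n} (hF : F ∈ flagsOf L) :
    F.shift ∈ flagsOf (extendLines L) := by
  obtain ⟨σ, hσ⟩ := hF
  -- The ordering in which the last line comes first, followed by the old lines in the order `σ`.
  obtain ⟨τ, h0, h1⟩ : ∃ τ : Equiv.Perm (Fin (n + 1)), τ 0 = Fin.last n ∧
      ∀ i : Fin n, τ i.succ = (σ i).castSucc :=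
    ⟨(finSuccEquiv n).trans (σ.optionCongr.trans finSuccEquivLast.symm), by simp, by simp⟩
  refine ⟨τ, fun k => ?_⟩
  refine Fin.cases ?_ (fun k => ?_) k
  · rw [FullFlag.bot]
    simp
  · simp only [FullFlag.shift, Fin.cons_succ, comap_projInit, hσ k, Submodule.map_iSup]
    apply le_antisymm
    · refine sup_le (iSup₂_le fun j hj => le_iSup₂_of_le j.succ ?_ ?_) (le_iSup₂_of_le 0 ?_ ?_)
      · rwa [Fin.castSucc_succ, Fin.succ_lt_succ_iff]
      · rw [h1, extendLines_castSucc]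
      · rw [Fin.castSucc_zero]
        exact Fin.succ_pos k
      · rw [h0, extendLines_last]
    · refine iSup₂_le fun j => ?_
      refine Fin.cases ?_ (fun j => ?_) j
      · intro _
        rw [h0, extendLines_last]
        exact le_sup_right
      · intro hj
        rw [Fin.castSucc_succ, Fin.succ_lt_succ_iff] at hj
        rw [h1, extendLines_castSucc]
        exact le_sup_of_le_left
          (le_iSup₂ (f := fun (j : Fin n) (_ : j.castSucc < k) => (L (σ j)).map (inclSucc A n)) j hj)

variable (A n) in
/-- The map `𝔽𝕃(Aⁿ) → 𝔽𝕃(Aⁿ⁺¹)` putting the last coordinate line at the bottom of the flags. -/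
def FLshift : SimplicialMap (FL A (Fin n → A) n) (FL A (Fin (n + 1) → A) (n + 1)) where
  toFun := FullFlag.shift
  map_face := by
    classical
    rintro s ⟨hs, L, hL, h⟩
    refine ⟨s.image FullFlag.shift, ⟨hs.image _, _, isSplitting_extendLines hL, ?_⟩,
      fun F hF => Finset.mem_image_of_mem _ hF⟩
    simpa [Finset.forall_mem_image] using fun F hF => shift_mem_flagsOf (h F hF)

/-- Both images of a simplex consist of flags of the one splitting `extendLines L`: only the
position of the last line in the ordering differs. -/
theorem contiguous_FLincl_FLshift : Contiguous (FLincl A n) (FLshift A n) := by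
  classical
  rintro s ⟨hs, L, hL, h⟩
  refine ⟨s.image FullFlag.extend ∪ s.image FullFlag.shift,
    ⟨(hs.image _).mono Finset.subset_union_left, _, isSplitting_extendLines hL, ?_⟩,
    fun F hF => ⟨Finset.mem_union_left _ (Finset.mem_image_of_mem _ hF),
      Finset.mem_union_right _ (Finset.mem_image_of_mem _ hF)⟩⟩
  intro F hF
  rcases Finset.mem_union.1 hF with hF | hF
  · obtain ⟨F', hF', rfl⟩ := Finset.mem_image.1 hF
    exact extend_mem_flagsOf hL (h F' hF')
  · obtain ⟨F', hF', rfl⟩ := Finset.mem_image.1 hF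
    exact shift_mem_flagsOf (h F' hF')

/-- Every step below the top lies in `Aⁿ`, where `g` is the identity. -/
theorem act_extend_of_fix (g : (Fin (n + 1) → A) ≃ₗ[A] (Fin (n + 1) → A))
    (hg : ∀ x, g (inclSucc A n x) = inclSucc A n x) (F : FullFlag A (Fin n → A) n) :
    F.extend.act g = F.extend := by
  have hcomp : g.toLinearMap.comp (inclSucc A n) = inclSucc A n := LinearMap.ext hg
  ext1
  funext k
  simp only [FullFlag.act, FullFlag.extend]
  refine Fin.lastCases ?_ (fun k => ?_) k
  · rw [Fin.snoc_last, Submodule.map_top, LinearEquiv.range]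
  · rw [Fin.snoc_castSucc, ← Submodule.map_comp, hcomp]

/-- Every nonzero step is a preimage under the projection, and `g` preserves the fibres of the
projection. -/
theorem act_shift_of_proj (g : (Fin (n + 1) → A) ≃ₗ[A] (Fin (n + 1) → A))
    (hg : ∀ x, projInit A n (g x) = projInit A n x) (F : FullFlag A (Fin n → A) n) :
    F.shift.act g = F.shift := by
  have hcomp : (projInit A n).comp g.toLinearMap = projInit A n := LinearMap.ext hg
  ext1
  funext k
  simp only [FullFlag.act, FullFlag.shift]
  refine Fin.cases ?_ (fun k => ?_) k
  · rw [Fin.cons_zero, Submodule.map_bot]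
  · rw [Fin.cons_succ]
    conv_lhs => rw [← hcomp, Submodule.comap_comp]
    exact Submodule.map_comap_eq_of_surjective g.surjective _

/-! ### Elementary automorphisms and the finite-rank statement -/

theorem elemAut_apply {i j : Fin n} (h : i ≠ j) (a : A) (x : Fin n → A) :
    elemAut A h a x = x + x i • Pi.single j a := rfl

theorem elemAut_inv {i j : Fin n} (h : i ≠ j) (a : A) :
    (elemAut A h a)⁻¹ = elemAut A h (-a) := by
  rw [inv_eq_iff_mul_eq_one]
  ext1 x
  simp [LinearEquiv.mul_apply, elemAut_apply, h, Pi.single_neg]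

/-- The Steinberg relation `[Eᵢₖ(a), Eₖⱼ(1)] = Eᵢⱼ(a)`. The factors appear in reverse because
matrices act on row vectors from the right. -/
theorem elemAut_commutator {i j k : Fin n} (hij : i ≠ j) (hik : i ≠ k) (hkj : k ≠ j) (a : A) :
    elemAut A hij a = (elemAut A hkj 1)⁻¹ * (elemAut A hik a)⁻¹ *
      elemAut A hkj 1 * elemAut A hik a := by
  rw [elemAut_inv, elemAut_inv]
  ext x m
  simp [LinearEquiv.mul_apply, elemAut_apply, hij, hik, hkj, Pi.single_apply]
  split_ifs <;> simp_all
  abel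

/-- The automorphisms of `Aⁿ⁺¹` acting trivially on the image of `H_r(𝔽𝕃(Aⁿ), ℤ)`. -/
def homologyStabilizer (A : Type u) [Ring A] (n r : ℕ) :
    Subgroup ((Fin (n + 1) → A) ≃ₗ[A] (Fin (n + 1) → A)) where
  carrier := {g | ∀ x, homologyMap (FLact g) r (homologyMap (FLincl A n) r x) =
    homologyMap (FLincl A n) r x}
  mul_mem' {g g'} hg hg' x := by
    rw [homologyMap_comp_apply (FLact g') (FLact g) (FLact (g * g')) (fun F => ?_), hg', hg]
    ext1
    funext k
    exact Submodule.map_comp g'.toLinearMap g.toLinearMap (F.sub k)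
  one_mem' x := homologyMap_eq_self _ (fun F => FullFlag.ext (funext fun _ => Submodule.map_id _))
    r _
  inv_mem' {g} hg x := by
    conv_lhs => rw [← hg x]
    rw [← homologyMap_comp_apply (FLact g) (FLact g⁻¹) (FLact (g⁻¹ * g)) (fun F => ?_)]
    · rw [inv_mul_cancel]
      exact homologyMap_eq_self _
        (fun F => FullFlag.ext (funext fun _ => Submodule.map_id _)) r _
    · ext1
      funext k
      exact Submodule.map_comp g.toLinearMap (g⁻¹).toLinearMap (F.sub k)

theorem mem_homologyStabilizer_of_fix (g : (Fin (n + 1) → A) ≃ₗ[A] (Fin (n + 1) → A))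
    (hg : ∀ x, g (inclSucc A n x) = inclSucc A n x) (r : ℕ) : g ∈ homologyStabilizer A n r :=
  fun x => (homologyMap_comp_apply (FLincl A n) (FLact g) (FLincl A n)
    (fun F => (act_extend_of_fix g hg F).symm) r x).symm

/-- Such a `g` need not fix the extended flags, but by contiguity the homology classes are equally
images under the shift, whose flags it does fix. -/
theorem mem_homologyStabilizer_of_proj (g : (Fin (n + 1) → A) ≃ₗ[A] (Fin (n + 1) → A))
    (hg : ∀ x, projInit A n (g x) = projInit A n x) (r : ℕ) : g ∈ homologyStabilizer A n r := by
  intro x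
  rw [contiguous_FLincl_FLshift.homologyMap_eq]
  exact (homologyMap_comp_apply (FLshift A n) (FLact g) (FLshift A n)
    (fun F => (act_shift_of_proj g hg F).symm) r x).symm

theorem elementaryGroup_le_homologyStabilizer (A : Type u) [Ring A] (n r : ℕ) :
    elementaryGroup A (n + 1) ≤ homologyStabilizer A n r := by
  -- The added multiple of `eⱼ` has the last coordinate as a factor, which vanishes on `Aⁿ`.
  have hlast : ∀ (j : Fin (n + 1)) (h : Fin.last n ≠ j) (a : A),
      elemAut A h a ∈ homologyStabilizer A n r := fun j h a =>
    mem_homologyStabilizer_of_fix _ (fun x => by simp [elemAut_apply]) r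
  -- Only the last coordinate changes, and the projection forgets it.
  have hproj : ∀ (i : Fin (n + 1)) (h : i ≠ Fin.last n) (a : A),
      elemAut A h a ∈ homologyStabilizer A n r := fun i h a =>
    mem_homologyStabilizer_of_proj _ (fun x => by ext m; simp [elemAut_apply]) r
  refine (Subgroup.closure_le _).2 ?_
  rintro g ⟨i, j, h, a, rfl⟩
  by_cases hi : i = Fin.last n
  · subst hi
    exact hlast j h a
  by_cases hj : j = Fin.last n
  · subst hj
    exact hproj i h a
  -- Neither index is the last one, so the last index can serve as the intermediate `k`.
  rw [SetLike.mem_coe, elemAut_commutator h hi (Ne.symm hj)]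
  exact mul_mem (mul_mem (mul_mem (inv_mem (hlast j _ _)) (inv_mem (hproj i _ _))) (hlast j _ _))
    (hproj i _ _)

end Standard

/-! ### Passage to `A^∞` -/

section Infinite

variable {A : Type u} [Ring A] {n : ℕ}

theorem FullFlag.toInf_injective :
    Function.Injective (FullFlag.toInf : FullFlag A (Fin n → A) n → InfFlag A) := by
  intro F G h
  ext1
  funext k
  have hk := congrFun (congrArg InfFlag.sub h) k
  simp only [FullFlag.toInf, dif_pos k.2] at hk
  exact Submodule.map_injective_of_injective (inclInf_injective n) hk

variable (A n) in
/-- The map `𝔽𝕃(Aⁿ) → 𝔽𝕃(A^∞)`. -/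
def FLtoInf : SimplicialMap (FL A (Fin n → A) n) (FLinf A) where
  toFun := FullFlag.toInf
  map_face := by
    classical
    intro s hs
    exact ⟨s.image FullFlag.toInf, ⟨hs.1.image _, n, s, hs, fun F hF => Finset.mem_image.1 hF⟩,
      fun F hF => Finset.mem_image_of_mem _ hF⟩

theorem exists_FLtoInf_eq (r : ℕ) (z : homology (FLinf A) r) :
    ∃ n x, homologyMap (FLtoInf A n) r x = z :=
  exists_homologyMap_eq (FLincl A) (FLtoInf A) (fun _ => FullFlag.toInf_injective)
    (fun _ F => F.extend_toInf) (fun _ hs => hs.2) r z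

/-- A class from rank `n` can be pushed to any higher rank along the inclusions, leaving room for
the indices of a given elementary automorphism. -/
theorem exists_FLtoInf_eq_of_le (N r : ℕ) (z : homology (FLinf A) r) :
    ∃ n, N ≤ n ∧ ∃ x, homologyMap (FLtoInf A n) r x = z := by
  obtain ⟨n, x, hx⟩ := exists_FLtoInf_eq r z
  refine ⟨max N n, le_max_left N n, ?_⟩
  induction max N n, le_max_right N n using Nat.le_induction with
  | base => exact ⟨x, hx⟩
  | succ m _ ih =>
    obtain ⟨y, rfl⟩ := ih
    exact ⟨_, (homologyMap_comp_apply (FLincl A m) (FLtoInf A (m + 1)) (FLtoInf A m)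
      (fun F => F.extend_toInf.symm) r y).symm⟩

theorem inclInf_elemAut {i j : Fin n} (h : i ≠ j) (h' : (i : ℕ) ≠ j) (a : A) (x : Fin n → A) :
    inclInf A n (elemAut A h a x) = elemAutInf A h' a (inclInf A n x) := by
  have hinf : elemAutInf A h' a (inclInf A n x) =
      inclInf A n x + inclInf A n x i • Finsupp.single (j : ℕ) a := rfl
  have hs : inclInf A n (Pi.single j a) = Finsupp.single (j : ℕ) a := by
    ext m
    by_cases hm : m < n
    · rw [inclInf_apply_lt (Pi.single j a) ⟨m, hm⟩]
      simp [Pi.single_apply, Finsupp.single_apply, Fin.ext_iff, eq_comm]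
    · rw [inclInf_apply_ge _ (not_lt.1 hm), Finsupp.single_eq_of_ne (by omega)]
  rw [elemAut_apply, map_add, map_smul, hs, hinf, inclInf_apply_lt]

theorem stableAt_elemAutInf {i j : ℕ} (h : i ≠ j) (a : A) (hi : i < n) (hj : j < n) :
    StableAt n (elemAutInf A h a) := by
  have h' : (⟨i, hi⟩ : Fin n) ≠ ⟨j, hj⟩ := by simpa using h
  refine ⟨?_, fun m hm => ?_⟩
  · have hcomp : (elemAutInf A h a).toLinearMap ∘ₗ inclInf A n =
        inclInf A n ∘ₗ (elemAut A h' a).toLinearMap :=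
      LinearMap.ext fun x => (inclInf_elemAut h' h a x).symm
    rw [stdSub, ← LinearMap.range_comp, hcomp, LinearMap.range_comp, LinearEquiv.range,
      Submodule.map_top]
  · have : m ≠ i := by omega
    simp [elemAutInf, LinearMap.transvection, Finsupp.single_eq_of_ne this.symm]

theorem toInf_act {g : GLinf A} (hg : StableAt n g.1) {g' : (Fin n → A) ≃ₗ[A] (Fin n → A)}
    (h : ∀ x, inclInf A n (g' x) = g.1 (inclInf A n x)) (F : FullFlag A (Fin n → A) n) :
    (F.act g').toInf = F.toInf.act g := by
  ext1
  funext k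
  have hcomp : inclInf A n ∘ₗ g'.toLinearMap = g.1.toLinearMap ∘ₗ inclInf A n := LinearMap.ext h
  simp only [FullFlag.toInf, FullFlag.act, InfFlag.act]
  by_cases hk : k < n + 1
  · rw [dif_pos hk, dif_pos hk, ← Submodule.map_comp, ← Submodule.map_comp, hcomp]
  · rw [dif_neg hk, dif_neg hk, (hg.mono (by omega)).1]

theorem homologyMap_elemAutInf {i j : ℕ} (h : i ≠ j) (a : A)
    (hg : elemAutInf A h a ∈ GLinf A) (r : ℕ) (z : homology (FLinf A) r) :
    homologyMap (FLinfAct ⟨elemAutInf A h a, hg⟩) r z = z := by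
  -- The bound `max i j ≤ n` is enough, as the automorphism only has to live on `Aⁿ⁺¹`, whose
  -- indices are `0, …, n`.
  obtain ⟨n, hn, y, rfl⟩ := exists_FLtoInf_eq_of_le (max i j) r z
  have hi : i < n + 1 := by omega
  have hj : j < n + 1 := by omega
  have h' : (⟨i, hi⟩ : Fin (n + 1)) ≠ ⟨j, hj⟩ := by simpa using h
  have hE : elemAut A h' a ∈ elementaryGroup A (n + 1) :=
    Subgroup.subset_closure ⟨_, _, h', a, rfl⟩
  rw [homologyMap_comp_apply (FLincl A n) (FLtoInf A (n + 1)) (FLtoInf A n)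
    (fun F => F.extend_toInf.symm)]
  conv_rhs => rw [← elementaryGroup_le_homologyStabilizer A n r hE y]
  -- The diagonal of the square comparing the actions on `Aⁿ⁺¹` and on `A^∞`; both composites agree
  -- with it on vertices.
  let k : SimplicialMap (FL A (Fin (n + 1) → A) (n + 1)) (FLinf A) :=
    (FLtoInf A (n + 1)).comp (FLact (elemAut A h' a))
  rw [← homologyMap_comp_apply _ _ k (fun F => ?_),
    ← homologyMap_comp_apply (FLact (elemAut A h' a)) (FLtoInf A (n + 1)) k (fun _ => rfl)]
  exact toInf_act (g := ⟨_, hg⟩) (stableAt_elemAutInf h a hi hj) (inclInf_elemAut h' h a) F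

/-- The elements of `GL(A)` acting trivially on `H_r(𝔽𝕃(A^∞), ℤ)`. -/
def homologyStabilizerInf (A : Type u) [Ring A] (r : ℕ) : Subgroup (GLinf A) where
  carrier := {g | ∀ x, homologyMap (FLinfAct g) r x = x}
  mul_mem' {g g'} hg hg' x := by
    rw [homologyMap_comp_apply (FLinfAct g') (FLinfAct g) (FLinfAct (g * g')) (fun F => ?_), hg',
      hg]
    ext1
    funext k
    exact Submodule.map_comp g'.1.toLinearMap g.1.toLinearMap (F.sub k)
  one_mem' x := homologyMap_eq_self _ (fun F => InfFlag.ext (funext fun _ => Submodule.map_id _))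
    r _
  inv_mem' {g} hg x := by
    conv_lhs => rw [← hg x]
    rw [← homologyMap_comp_apply (FLinfAct g) (FLinfAct g⁻¹) (FLinfAct (g⁻¹ * g)) (fun F => ?_)]
    · rw [inv_mul_cancel]
      exact homologyMap_eq_self _
        (fun F => InfFlag.ext (funext fun _ => Submodule.map_id _)) r _
    · ext1
      funext k
      exact Submodule.map_comp g.1.toLinearMap (g⁻¹).1.toLinearMap (F.sub k)

/-- `E(A)` is generated inside `Aut(A^∞)`, whereas the action is defined only on `GL(A)`; hence the
comparison with the image of the stabilizer. -/
theorem elementaryGroupInf_le_homologyStabilizerInf (A : Type u) [Ring A] (r : ℕ) :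
    elementaryGroupInf A ≤ (homologyStabilizerInf A r).map (GLinf A).subtype := by
  refine (Subgroup.closure_le _).2 ?_
  rintro g ⟨i, j, h, a, rfl⟩
  have hg : elemAutInf A h a ∈ GLinf A :=
    elementaryGroupInf_le (Subgroup.subset_closure ⟨i, j, h, a, rfl⟩)
  exact ⟨⟨_, hg⟩, homologyMap_elemAutInf h a hg r, rfl⟩

end Infinite

end FlagComplex

end

theorem mainTheorem12 (A : Type u) [Ring A] [InvariantBasisNumber A] :
    (∀ (n r : ℕ), ∀ g ∈ FlagComplex.elementaryGroup A (n + 1),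
      ∀ x ∈ LinearMap.range (FlagComplex.homologyMap (FlagComplex.FLincl A n) r),
        FlagComplex.homologyMap (FlagComplex.FLact g) r x = x) ∧
    (∀ (r : ℕ) (g : (ℕ →₀ A) ≃ₗ[A] (ℕ →₀ A)) (hg : g ∈ FlagComplex.elementaryGroupInf A),
      ∀ x : FlagComplex.homology (FlagComplex.FLinf A) r,
        FlagComplex.homologyMap
          (FlagComplex.FLinfAct ⟨g, FlagComplex.elementaryGroupInf_le hg⟩) r x = x) := by
  refine ⟨fun n r g hg => ?_, fun r g hg x => ?_⟩
  · rintro _ ⟨x, rfl⟩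
    exact FlagComplex.elementaryGroup_le_homologyStabilizer A n r hg x
  · obtain ⟨g', hg', rfl⟩ := FlagComplex.elementaryGroupInf_le_homologyStabilizerInf A r hg
    exact hg' x
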